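/- Write $z_j=x_j+\mathrm{i}y_j$ for the coordinates of $\mathbb{C}^2$, let $S^3=\{|z_1|^2+|z_2|^2=1\}$ carry the standard contact structure $\ker\sum_{j=1}^2(x_j\,dy_j-y_j\,dx_j)$, let $\cdot$ be the standard scalar product of $\mathbb{R}^4=\mathbb{C}^2$, and put $$v_1=-x_2\partial_{x_1}+y_2\partial_{y_1}+x_1\partial_{x_2}-y_1\partial_{y_2},\qquad v_2=-y_2\partial_{x_1}-x_2\partial_{y_1}+y_1\partial_{x_2}+x_1\partial_{y_2}.$$ For $t\in\mathbb{R}$ and $(x,y,z)\in\mathbb{R}^3$ let $$\alpha=\frac{x^2+y^2+z^2-t^2-1+2\mathrm{i}z}{x^2+y^2+z^2-(t-\mathrm{i})^2},\qquad \beta=\frac{2(x-\mathrm{i}y)}{x^2+y^2+z^2-(t-\mathrm{i})^2},$$ and let $\nabla$ be the gradient in $(x,y,z)$. Let $L=L_1\cup\dots\cup L_n\subset S^3$ be a smooth $n$-component Legendrian link with $(1,0)\notin L$, let $I\subset\{1,\dots,n\}$, and let $X$ be a nowhere vanishing section of the tangent bundle of $L$. Define $H:L\to\mathbb{C}$ by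 $$H=X\cdot v_1-\mathrm{i}\,X\cdot v_2\ \text{ on } L_i,\ i\in I,\qquad H=X\cdot v_2+\mathrm{i}\,X\cdot v_1\ \text{ on } L_i,\ i\notin I.$$ Suppose that there are an open neighbourhood $U$ of $S^3$ in $\mathbb{C}^2$ and a holomorphic function $h:U\to\mathbb{C}$ with $h|_L=H$, and let $\mathbf{F}=\mathbf{E}+\mathrm{i}\mathbf{B}=h(\alpha,\beta)\,\nabla\alpha\times\nabla\beta$, where $\mathbf{E}$ and $\mathbf{B}$ are real. Then for every time $t\in\mathbb{R}$ there are sets $K_1,\dots,K_n\subset\mathbb{R}^3$ such that $K_i$ is a closed field line of the electric field $\mathbf{E}(t,\cdot)$ for $i\in I$ and of the magnetic field $\mathbf{B}(t,\cdot)$ for $i\notin I$, and such that a single smooth ambient isotopy of $\mathbb{R}^3$ carries the mirror image of $L_i$ onto $K_i$ for all $i$. In particular, for all time, $\bigcup_i K_i$ is ambient isotopic to the mirror image of $L$, the set of closed electric field lines $\bigcup_{i\in I}K_i$ to the mirror image of $\bigcup_{i\in I}L_i$, and the set of closed magnetic field lines $\bigcup_{i\notin I}K_i$ to the mirror image of $\bigcup_{i\notin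 I}L_i$. Here a closed field line of a vector field is the image of a periodic integral curve along which the field does not vanish, and the mirror image of $L_i$ is its image under $(z_1,z_2)\mapsto(z_1,\overline{z_2})$, viewed in $\mathbb{R}^3$ through the standard stereographic projection from $(1,0)$, whose inverse is $$(x,y,z)\mapsto\left(\frac{x^2+y^2+z^2-1+2\mathrm{i}z}{x^2+y^2+z^2+1},\ \frac{2(x+\mathrm{i}y)}{x^2+y^2+z^2+1}\right).$$ -/

import Mathlib

open scoped Matrix ContDiff ComplexConjugate

namespace BatemanLinks

/-- `ℝ³` with coordinates `(x, y, z)`. Only its topology and smooth structure are used, and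
lengths are always written out in coordinates. -/
abbrev R3 : Type := Fin 3 → ℝ

/-- `ℂ²` with coordinates `(z₁, z₂)`. Only its topology and smooth structure are used. -/
abbrev C2 : Type := ℂ × ℂ

/-- The unit sphere `S³ ⊂ ℂ²`. -/
def S3 : Set C2 := {p | Complex.normSq p.1 + Complex.normSq p.2 = 1}

noncomputable section

/-! ## Bateman's construction with the Hopfion variables -/

/-- `|q|² = x² + y² + z²`. -/
def sqLen (q : R3) : ℝ := q 0 ^ 2 + q 1 ^ 2 + q 2 ^ 2

/-- The common denominator `x² + y² + z² - (t - i)²` of `α` and `β`; it never vanishes. -/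
def den (t : ℝ) (q : R3) : ℂ := (sqLen q : ℂ) - ((t : ℂ) - Complex.I) ^ 2

/-- The function `α(t, x, y, z)`. -/
def alpha (t : ℝ) (q : R3) : ℂ :=
  ((sqLen q : ℂ) - (t : ℂ) ^ 2 - 1 + 2 * Complex.I * (q 2 : ℂ)) / den t q

/-- The function `β(t, x, y, z)`. -/
def beta (t : ℝ) (q : R3) : ℂ :=
  2 * ((q 0 : ℂ) - Complex.I * (q 1 : ℂ)) / den t q

/-- The gradient of a complex-valued function on `ℝ³`: the vector of its partial derivatives. -/
def gradient (f : R3 → ℂ) (q : R3) : Fin 3 → ℂ :=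
  fun j => fderiv ℝ f q (Pi.single j 1)

/-- The field `F(t, ·) = h(α, β) ∇α × ∇β`, with values in `ℂ³`. -/
def batemanField (h : C2 → ℂ) (t : ℝ) (q : R3) : Fin 3 → ℂ :=
  h (alpha t q, beta t q) • (gradient (alpha t) q ⨯₃ gradient (beta t) q)

/-- The electric field at time `t`: `E = Re F`. -/
def electricField (h : C2 → ℂ) (t : ℝ) (q : R3) : R3 :=
  fun j => (batemanField h t q j).re

/-- The magnetic field at time `t`: `B = Im F`. -/
def magneticField (h : C2 → ℂ) (t : ℝ) (q : R3) : R3 :=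
  fun j => (batemanField h t q j).im

/-- `K` is a closed field line of the vector field `G` on `ℝ³`: the image of a periodic integral
curve of `G` along which `G` does not vanish. -/
def IsClosedFieldLine (G : R3 → R3) (K : Set R3) : Prop :=
  ∃ (c : ℝ → R3) (T : ℝ), 0 < T ∧ Function.Periodic c T ∧
    (∀ s, HasDerivAt c (G (c s)) s) ∧ (∀ s, G (c s) ≠ 0) ∧ K = Set.range c

/-! ## Links in the three-sphere -/

/-- `L₁ ∪ ⋯ ∪ Lₙ` is an `n`-component link in `S³`, parametrised by `γ`: the `i`-th component
`Lᵢ` is the image of the `2π`-periodic curve `γ i`, and together these curves form a smooth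
embedding of `n` disjoint circles `ℝ / 2πℤ` in `S³`. -/
structure IsLinkParam {n : ℕ} (γ : Fin n → ℝ → C2) : Prop where
  smooth : ∀ i, ContDiff ℝ ∞ (γ i)
  periodic : ∀ i, Function.Periodic (γ i) (2 * Real.pi)
  immersed : ∀ i s, deriv (γ i) s ≠ 0
  injective : ∀ i j s s', γ i s = γ j s' → i = j ∧ ∃ k : ℤ, s' = s + k * (2 * Real.pi)
  mem_sphere : ∀ i s, γ i s ∈ S3

/-- The standard contact form `α₀ = ∑ⱼ (xⱼ dyⱼ - yⱼ dxⱼ)` at the point `p`, applied to the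
vector `w`. -/
def contactForm (p w : C2) : ℝ :=
  (p.1.re * w.1.im - p.1.im * w.1.re) + (p.2.re * w.2.im - p.2.im * w.2.re)

/-- The link is everywhere tangent to the planes of the standard contact structure `ker α₀`. -/
def IsLegendrian {n : ℕ} (γ : Fin n → ℝ → C2) : Prop :=
  ∀ i s, contactForm (γ i s) (deriv (γ i) s) = 0

/-- Along the link, `X` is a nowhere vanishing section of the tangent bundle of the link, i.e.
its value at each point is a nonzero real multiple of the velocity vector. -/
def IsNonvanishingTangentSection {n : ℕ} (γ : Fin n → ℝ → C2) (X : C2 → C2) : Prop :=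
  ∀ i s, ∃ c : ℝ, c ≠ 0 ∧ X (γ i s) = c • deriv (γ i) s

/-- The standard scalar product of `ℝ⁴ = ℂ²`. -/
def dot4 (v w : C2) : ℝ :=
  v.1.re * w.1.re + v.1.im * w.1.im + v.2.re * w.2.re + v.2.im * w.2.im

/-- `v₁ = -x₂ ∂/∂x₁ + y₂ ∂/∂y₁ + x₁ ∂/∂x₂ - y₁ ∂/∂y₂`. -/
def v1 (p : C2) : C2 := (⟨-p.2.re, p.2.im⟩, ⟨p.1.re, -p.1.im⟩)

/-- `v₂ = -y₂ ∂/∂x₁ - x₂ ∂/∂y₁ + y₁ ∂/∂x₂ + x₁ ∂/∂y₂`. -/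
def v2 (p : C2) : C2 := (⟨-p.2.im, -p.2.re⟩, ⟨p.1.im, p.1.re⟩)

/-- The value at the point `p` of the `i`-th component of the link of the function `H`
associated with the section `X` and the set `I` of component indices. -/
def coeffH {n : ℕ} (I : Finset (Fin n)) (X : C2 → C2) (i : Fin n) (p : C2) : ℂ :=
  if i ∈ I then ⟨dot4 (X p) (v1 p), -dot4 (X p) (v2 p)⟩
  else ⟨dot4 (X p) (v2 p), dot4 (X p) (v1 p)⟩

/-! ## Mirror images and ambient isotopy -/

/-- The inverse `ℝ³ → S³ ∖ {(1, 0)}` of the standard stereographic projection. -/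
def stereoInv (q : R3) : C2 :=
  (((sqLen q : ℂ) - 1 + 2 * Complex.I * (q 2 : ℂ)) / ((sqLen q : ℂ) + 1),
    2 * ((q 0 : ℂ) + Complex.I * (q 1 : ℂ)) / ((sqLen q : ℂ) + 1))

/-- The mirror reflection `(z₁, z₂) ↦ (z₁, conj z₂)` of `S³`. -/
def reflection (p : C2) : C2 := (p.1, conj p.2)

/-- The mirror image of a subset `A` of `S³ ∖ {(1, 0)}`, viewed in `ℝ³` through the standard
stereographic projection. -/
def mirrorImage (A : Set C2) : Set R3 := {q | stereoInv q ∈ reflection '' A}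

/-- A smooth ambient isotopy `Φ` of `ℝ³`: a smooth family of diffeomorphisms starting at the
identity. -/
def IsAmbientIsotopy (Φ : ℝ → R3 → R3) : Prop :=
  Φ 0 = id ∧ ContDiff ℝ ∞ (fun p : ℝ × R3 => Φ p.1 p.2) ∧
    ∃ Ψ : ℝ → R3 → R3, ContDiff ℝ ∞ (fun p : ℝ × R3 => Ψ p.1 p.2) ∧
      ∀ s, Function.LeftInverse (Ψ s) (Φ s) ∧ Function.RightInverse (Ψ s) (Φ s)

/-- Two links in `ℝ³` with components `Aᵢ` and `Bᵢ` are ambient isotopic, with corresponding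
components: one ambient isotopy carries every `Aᵢ` onto `Bᵢ`. It then carries the union of the
`Aᵢ` over any set of indices onto the union of the `Bᵢ` over the same set. -/
def AmbientIsotopic {n : ℕ} (A B : Fin n → Set R3) : Prop :=
  ∃ Φ : ℝ → R3 → R3, IsAmbientIsotopy Φ ∧ ∀ i, Φ 1 '' A i = B i

end

end BatemanLinks

namespace BatemanLinks

/-! At each time t the map φ_t = (α, β), `hopf t`, is a diffeomorphism from ℝ³ onto S³ ∖ {(1, 0)},
with inverse `hopfInv t`. The field lines wanted are K_i = φ_t⁻¹(L_i).

Put G = ∇α × ∇β. The triple products ∇α · G and ∇β · G vanish, while ∇α · conj G = -J conj β and ∇β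
· conj G = J conj α with J > 0. Hence dφ_t maps Re(ηG) = (ηG + conj(ηG))/2 to (J/2) conj η · (-conj
β, conj α) (`fderiv_hopf_re`). Now v₁ = (-conj z₂, conj z₁) and v₂ = i v₁, so the contact plane is
the complex line through v₁, and a Legendrian vector w equals (w·v₁ + i w·v₂) v₁
(`eq_mul_v1_of_legendrian`). The values prescribed for h make conj h, respectively i conj h, equal
to X·v₁ + i X·v₂. So E, respectively B = Re(-iF), is pushed forward to (J/2) X along L_i. The field
is therefore tangent to K_i and nonzero there, and a change of time turns K_i into a periodic
integral curve (`isClosedFieldLine_of_tangent`).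

The isotopy is s ↦ φ_{st}⁻¹ ∘ φ₀. It starts at the identity and ends by carrying φ₀⁻¹(L_i) onto K_i.
Moreover φ₀⁻¹(L_i) is the mirror image of L_i, since φ₀ is inverse stereographic projection followed
by conjugation of z₂. -/

/-! ### Reparametrising a closed curve into an integral curve -/

/-- An antiderivative of a continuous positive periodic function has a global inverse, which
solves the corresponding autonomous differential equation. -/
theorem exists_periodic_reparam_of_pos {m : ℝ → ℝ} (hm : Continuous m) {P : ℝ} (hP : 0 < P)
    (hper : Function.Periodic m P) (hpos : ∀ s, 0 < m s) :
    ∃ (σ : ℝ → ℝ) (T : ℝ), 0 < T ∧ (∀ u, σ (u + T) = σ u + P) ∧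
      (∀ u, HasDerivAt σ (m (σ u)) u) ∧ Function.Surjective σ := by
  set f : ℝ → ℝ := fun s => (m s)⁻¹ with hf
  have hfc : Continuous f := hm.inv₀ fun s => (hpos s).ne'
  have hfper : Function.Periodic f P := fun s => by simp only [hf, hper s]
  have hfpos : ∀ s, 0 < f s := fun s => inv_pos.2 (hpos s)
  have hint : ∀ a b, IntervalIntegrable f MeasureTheory.volume a b :=
    fun a b => hfc.intervalIntegrable a b
  set F : ℝ → ℝ := fun s => ∫ x in (0 : ℝ)..s, f x with hF
  have hFd : ∀ s, HasDerivAt F (f s) s := fun s =>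
    intervalIntegral.integral_hasDerivAt_right (hint 0 s)
      hfc.aestronglyMeasurable.stronglyMeasurableAtFilter hfc.continuousAt
  have hFc : Continuous F := continuous_iff_continuousAt.2 fun s => (hFd s).continuousAt
  have hmono : StrictMono F :=
    strictMono_of_deriv_pos fun s => by rw [(hFd s).deriv]; exact hfpos s
  set T : ℝ := F P with hT
  have hTpos : 0 < T := by
    have : F 0 = 0 := by simp [hF]
    rw [← this]; exact hmono hP
  -- Periodicity makes F grow by the fixed amount T > 0 over each period; hence F is unbounded in
  -- both directions, thus bijective, and its inverse advances by P in time T.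
  have hadd : ∀ s, F (s + P) = F s + T := fun s => by
    have h1 : F (s + P) = F s + ∫ x in s..(s + P), f x :=
      (intervalIntegral.integral_add_adjacent_intervals (hint 0 s) (hint s (s + P))).symm
    rw [h1, hfper.intervalIntegral_add_eq s 0, zero_add]
  have haddn : ∀ (k : ℕ), F (k * P) = k * T := fun k => by
    induction k with
    | zero => simp [hF]
    | succ k ih => push_cast; rw [add_mul, one_mul, hadd, ih]; ring
  have hsubn : ∀ (k : ℕ), F (-(k * P)) = -(k * T) := fun k => by
    induction k with
    | zero => simp [hF]
    | succ k ih =>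
      have := hadd (-((k + 1 : ℕ) * P))
      have e : -(((k + 1 : ℕ) : ℝ) * P) + P = -(k * P) := by push_cast; ring
      rw [e, ih] at this
      push_cast at this ⊢
      linarith
  have hsurj : Function.Surjective F := by
    apply hFc.surjective
    · refine Filter.tendsto_atTop_atTop_of_monotone hmono.monotone fun b => ?_
      obtain ⟨k, hk⟩ := exists_nat_ge (b / T)
      exact ⟨k * P, by rw [haddn]; exact (div_le_iff₀ hTpos).1 hk⟩
    · refine Filter.tendsto_atBot_atBot_of_monotone hmono.monotone fun b => ?_
      obtain ⟨k, hk⟩ := exists_nat_ge (-b / T)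
      exact ⟨-(k * P), by rw [hsubn]; have := (div_le_iff₀ hTpos).1 hk; linarith⟩
  set e : ℝ ≃o ℝ := hmono.orderIsoOfSurjective F hsurj with he
  have hFe : ∀ u, F (e.symm u) = u := fun u => e.apply_symm_apply u
  have heF : ∀ s, e.symm (F s) = s := fun s => e.symm_apply_apply s
  refine ⟨e.symm, T, hTpos, fun u => ?_, fun u => ?_, e.symm.surjective⟩
  · apply hmono.injective
    rw [hadd, hFe, hFe]
  · have := HasDerivAt.of_local_left_inverse (f := F) (g := e.symm) (a := u)
      e.symm.continuous.continuousAt (hFd _) (hfpos _).ne' (Filter.Eventually.of_forall hFe)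
    simpa [hf] using this

/-- A continuous nowhere zero m has constant sign. If it is negative, the solution for -m is run
backwards in time, so the integer `k` is 1 or -1. -/
theorem exists_periodic_reparam {m : ℝ → ℝ} (hm : Continuous m) {P : ℝ} (hP : 0 < P)
    (hper : Function.Periodic m P) (hne : ∀ s, m s ≠ 0) :
    ∃ (σ : ℝ → ℝ) (T : ℝ), 0 < T ∧ (∀ u, ∃ k : ℤ, σ (u + T) = σ u + k * P) ∧
      (∀ u, HasDerivAt σ (m (σ u)) u) ∧ Function.Surjective σ := by
  have hsign : (∀ s, 0 < m s) ∨ ∀ s, m s < 0 := by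
    by_contra! hcon
    obtain ⟨⟨a, ha⟩, b, hb⟩ := hcon
    obtain ⟨s, hs⟩ := mem_range_of_exists_le_of_exists_ge hm ⟨a, ha⟩ ⟨b, hb⟩
    exact hne s hs
  rcases hsign with hpos | hneg
  · obtain ⟨σ, T, hT, h1, h2, h3⟩ := exists_periodic_reparam_of_pos hm hP hper hpos
    exact ⟨σ, T, hT, fun u => ⟨1, by rw [h1]; simp⟩, h2, h3⟩
  · obtain ⟨σ, T, hT, h1, h2, h3⟩ := exists_periodic_reparam_of_pos hm.neg hP
      (fun s => congrArg Neg.neg (hper s)) (fun s => neg_pos.2 (hneg s))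
    refine ⟨fun u => σ (-u), T, hT, fun u => ⟨-1, ?_⟩, fun u => ?_, fun s => ?_⟩
    · have := h1 (-(u + T))
      rw [show -(u + T) + T = -u by ring] at this
      push_cast
      linarith
    · have := (h2 (-u)).scomp u (hasDerivAt_neg u)
      rw [neg_smul, one_smul, Pi.neg_apply, neg_neg] at this
      exact this
    · obtain ⟨u, rfl⟩ := h3 s
      exact ⟨-u, by simp⟩

/-- A closed regular curve which is everywhere tangent to a continuous vector field that does not
vanish along the curve is a closed field line. -/
theorem isClosedFieldLine_of_tangent {G : R3 → R3} (hG : Continuous G) {c : ℝ → R3}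
    (hc : ContDiff ℝ 1 c) {P : ℝ} (hP : 0 < P) (hper : Function.Periodic c P)
    (hreg : ∀ s, deriv c s ≠ 0) (htan : ∀ s, ∃ m : ℝ, m ≠ 0 ∧ G (c s) = m • deriv c s) :
    IsClosedFieldLine G (Set.range c) := by
  choose m hm0 hm using htan
  have hc' : Continuous (deriv c) := hc.continuous_deriv le_rfl
  have hper' : Function.Periodic (deriv c) P := fun s => by
    rw [← deriv_comp_add_const]
    exact congrArg (fun f => deriv f s) (funext hper)
  have hdot : ∀ s, deriv c s ⬝ᵥ deriv c s ≠ 0 := fun s => by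
    simpa [dotProduct_self_eq_zero] using hreg s
  -- The factor was chosen pointwise; this formula shows that it is continuous and periodic.
  have hmeq : m = fun s => (G (c s) ⬝ᵥ deriv c s) / (deriv c s ⬝ᵥ deriv c s) := funext fun s => by
    rw [hm, smul_dotProduct, smul_eq_mul, mul_div_assoc, div_self (hdot s), mul_one]
  have hmc : Continuous m := by
    rw [hmeq]
    exact ((hG.comp hc.continuous).dotProduct hc').div (hc'.dotProduct hc') hdot
  have hmper : Function.Periodic m P := fun s => by
    rw [hmeq]; simp only [hper s, hper' s]
  obtain ⟨σ, T, hT, h1, h2, h3⟩ := exists_periodic_reparam hmc hP hmper hm0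
  refine ⟨c ∘ σ, T, hT, fun u => ?_, fun u => ?_, fun u => ?_, ?_⟩
  · obtain ⟨k, hk⟩ := h1 u
    simp only [Function.comp_apply, hk]
    exact (hper.int_mul k) _
  · have := ((hc.differentiable one_ne_zero (σ u)).hasDerivAt).scomp u (h2 u)
    simpa only [Function.comp_apply, hm] using this
  · simp only [Function.comp_apply, hm]
    exact smul_ne_zero (hm0 _) (hreg _)
  · rw [h3.range_comp]

noncomputable section

/-! ### The Hopfion variables as a diffeomorphism onto the punctured sphere -/

/-- The map `ℝ³ → S³ ∖ {(1, 0)}` given by the variables `(α, β)` at time `t`. -/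
def hopf (t : ℝ) (q : R3) : C2 := (alpha t q, beta t q)

/-- The inverse of `hopf t`. -/
def hopfInv (t : ℝ) (p : C2) : R3 :=
  let u : ℂ := 2 / (1 - p.1)
  let w : ℝ := (u.im - 2 * t) / u.re
  let v : ℂ := p.2 / (1 - p.1) * (1 - Complex.I * (w : ℂ))
  ![v.re, -v.im, w + t]

theorem den_ne_zero (t : ℝ) (q : R3) : den t q ≠ 0 := fun hz => by
  have h1 := congrArg Complex.re hz
  have h2 := congrArg Complex.im hz
  simp [den, sqLen, pow_two] at h1 h2
  have ht : t = 0 := by linarith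
  subst ht
  nlinarith [sq_nonneg (q 0), sq_nonneg (q 1), sq_nonneg (q 2)]

/-- Written in w = z - t, the denominator divided by 1 - iw has a transparent real and imaginary
part, which is what makes (α, β) invertible. -/
theorem den_eq (t : ℝ) (q : R3) : den t q =
    (q 0 : ℂ) ^ 2 + (q 1 : ℂ) ^ 2 + (1 + Complex.I * ((q 2 : ℂ) - t)) *
      (1 - Complex.I * ((q 2 : ℂ) - t)) + 2 * Complex.I * t * (1 - Complex.I * ((q 2 : ℂ) - t)) := by
  simp only [den, sqLen]
  push_cast
  linear_combination (-(1 : ℂ) + q 2 ^ 2 - (t : ℂ) ^ 2) * Complex.I_sq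

theorem one_sub_alpha (t : ℝ) (q : R3) :
    1 - alpha t q = 2 * (1 - Complex.I * ((q 2 : ℂ) - t)) / den t q := by
  rw [alpha, eq_div_iff (den_ne_zero t q), sub_mul, div_mul_cancel₀ _ (den_ne_zero t q)]
  simp only [den]
  linear_combination -Complex.I_sq

theorem one_sub_I_mul_ne_zero (w : ℝ) : (1 : ℂ) - Complex.I * w ≠ 0 := fun hz => by
  simpa using congrArg Complex.re hz

theorem one_sub_alpha_ne_zero (t : ℝ) (q : R3) : 1 - alpha t q ≠ 0 := by
  rw [one_sub_alpha]
  have := one_sub_I_mul_ne_zero (q 2 - t)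
  push_cast at this
  exact div_ne_zero (mul_ne_zero two_ne_zero this) (den_ne_zero t q)

theorem hopf_mem_S3 (t : ℝ) (q : R3) : hopf t q ∈ S3 := by
  have hd : Complex.normSq (den t q) ≠ 0 := by simpa using den_ne_zero t q
  simp only [S3, Set.mem_ofPred_eq, hopf, alpha, beta, Complex.normSq_div]
  rw [← add_div, div_eq_one_iff_eq hd]
  simp [Complex.normSq_apply, den, sqLen, pow_two]
  ring

theorem one_sub_fst_ne_zero {p : C2} (hp : p ∈ S3) (hp1 : p ≠ (1, 0)) : 1 - p.1 ≠ 0 := fun hz => by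
  have h1 : p.1 = 1 := (sub_eq_zero.1 hz).symm
  have h2 : p.2 = 0 := by
    have : Complex.normSq p.1 + Complex.normSq p.2 = 1 := hp
    simpa [h1] using this
  exact hp1 (Prod.ext h1 h2)

/-- The Cayley transform sends the punctured sphere to a paraboloid: this is |1 - z₁|² + 1 - |z₁|² =
2(1 - Re z₁) divided by |1 - z₁|². -/
theorem two_div_one_sub_re {p : C2} (hp : p ∈ S3) (hp1 : 1 - p.1 ≠ 0) :
    (2 / (1 - p.1)).re = 1 + Complex.normSq (p.2 / (1 - p.1)) := by
  have hn : Complex.normSq (1 - p.1) ≠ 0 := by simpa using hp1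
  have hs : Complex.normSq p.1 + Complex.normSq p.2 = 1 := hp
  rw [Complex.normSq_div, Complex.div_re]
  field_simp
  simp [Complex.normSq_apply] at hs ⊢
  linarith

theorem two_div_one_sub_re_pos {p : C2} (hp : p ∈ S3) (hp1 : 1 - p.1 ≠ 0) :
    0 < (2 / (1 - p.1)).re := by
  rw [two_div_one_sub_re hp hp1]
  have := Complex.normSq_nonneg (p.2 / (1 - p.1))
  linarith

theorem hopfInv_eq {t w : ℝ} {p : C2} {v : ℂ}
    (hw : ((2 / (1 - p.1)).im - 2 * t) / (2 / (1 - p.1)).re = w)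
    (hv : p.2 / (1 - p.1) * (1 - Complex.I * (w : ℂ)) = v) :
    hopfInv t p = ![v.re, -v.im, w + t] := by
  subst hw hv
  rfl

theorem beta_div_one_sub_alpha (t : ℝ) (q : R3) : beta t q / (1 - alpha t q) =
    ((q 0 : ℂ) - Complex.I * (q 1 : ℂ)) / (1 - Complex.I * (q 2 - t : ℝ)) := by
  have hd := den_ne_zero t q
  have hw := one_sub_I_mul_ne_zero (q 2 - t)
  rw [one_sub_alpha, beta, ← Complex.ofReal_sub]
  field_simp

/-- Source of the formula for `hopfInv`: the imaginary part of u = 2/(1 - α) is Re u · (z - t) + 2t,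
so u determines z, after which β/(1 - α) determines x - iy. -/
theorem two_div_one_sub_alpha (t : ℝ) (q : R3) : 2 / (1 - alpha t q) =
    ((2 / (1 - alpha t q)).re : ℂ) * (1 + Complex.I * (q 2 - t : ℝ)) + Complex.I * (2 * t : ℝ) := by
  have hre := two_div_one_sub_re (hopf_mem_S3 t q) (one_sub_alpha_ne_zero t q)
  simp only [hopf] at hre
  rw [hre, beta_div_one_sub_alpha, Complex.normSq_div]
  have hD := den_ne_zero t q
  have hw0 := one_sub_I_mul_ne_zero (q 2 - t)
  have hw1 : (1 : ℂ) + Complex.I * (q 2 - t : ℝ) ≠ 0 := by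
    have := one_sub_I_mul_ne_zero (-(q 2 - t))
    rwa [Complex.ofReal_neg, mul_neg, sub_neg_eq_add] at this
  rw [one_sub_alpha]
  rw [den_eq] at hD ⊢
  rw [← Complex.ofReal_sub] at hD ⊢
  generalize q 2 - t = w at *
  have e1 : Complex.normSq ((q 0 : ℂ) - Complex.I * (q 1 : ℂ)) = q 0 ^ 2 + q 1 ^ 2 := by
    simp [Complex.normSq_apply, pow_two]
  have e2 : ((Complex.normSq (1 - Complex.I * w) : ℝ) : ℂ)
      = (1 - Complex.I * w) * (1 + Complex.I * w) := by
    rw [← Complex.mul_conj]; simp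
  push_cast
  rw [e1, e2]
  push_cast
  field_simp
  ring

theorem hopfInv_hopf (t : ℝ) (q : R3) : hopfInv t (hopf t q) = q := by
  have hpos : 0 < (2 / (1 - alpha t q)).re :=
    two_div_one_sub_re_pos (p := hopf t q) (hopf_mem_S3 t q) (one_sub_alpha_ne_zero t q)
  have him := congrArg Complex.im (two_div_one_sub_alpha t q)
  have hwq : ((2 / (1 - alpha t q)).im - 2 * t) / (2 / (1 - alpha t q)).re = q 2 - t := by
    rw [div_eq_iff hpos.ne']
    rw [Complex.add_im, Complex.im_ofReal_mul] at him
    simp only [Complex.add_im, Complex.one_im, Complex.I_mul_im, Complex.ofReal_re] at him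
    linarith
  have hv : beta t q / (1 - alpha t q) * (1 - Complex.I * (q 2 - t : ℝ))
      = (q 0 : ℂ) - Complex.I * (q 1 : ℂ) := by
    rw [beta_div_one_sub_alpha, div_mul_cancel₀ _ (one_sub_I_mul_ne_zero _)]
  rw [hopfInv_eq (p := hopf t q) hwq hv]
  funext j
  fin_cases j <;> simp

theorem hopf_hopfInv (t : ℝ) {p : C2} (hp : p ∈ S3) (hp1 : p ≠ (1, 0)) :
    hopf t (hopfInv t p) = p := by
  have h1 := one_sub_fst_ne_zero hp hp1
  have hre := two_div_one_sub_re hp h1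
  have hpos := two_div_one_sub_re_pos hp h1
  set u := 2 / (1 - p.1) with hu
  set b := p.2 / (1 - p.1) with hb
  set w : ℝ := (u.im - 2 * t) / u.re with hw
  set q := hopfInv t p
  have hw0 := one_sub_I_mul_ne_zero w
  have hz : (q 2 : ℂ) - t = w := by
    have : q 2 = w + t := rfl
    rw [this]; push_cast; ring
  have hx : q 0 = (b * (1 - Complex.I * w)).re := rfl
  have hy : q 1 = -(b * (1 - Complex.I * w)).im := rfl
  have hxy : (q 0 : ℂ) - Complex.I * (q 1 : ℂ) = b * (1 - Complex.I * w) := by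
    rw [hx, hy]
    apply Complex.ext <;> simp
  have hxy2 : (q 0 : ℂ) ^ 2 + (q 1 : ℂ) ^ 2
      = Complex.normSq b * ((1 - Complex.I * w) * (1 + Complex.I * w)) := by
    have : (q 0 : ℂ) ^ 2 + (q 1 : ℂ) ^ 2 = (b * (1 - Complex.I * w)) * conj (b * (1 - Complex.I * w)) := by
      rw [← hxy]
      simp
      linear_combination (q 1 : ℂ) ^ 2 * Complex.I_sq
    rw [this, ← Complex.mul_conj]
    simp
    ring
  have huw : u = (1 + Complex.normSq b : ℝ) * (1 + Complex.I * w) + 2 * Complex.I * t := by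
    rw [← hre]
    apply Complex.ext
    · simp
    · simp [hw]; field_simp; ring
  -- With this factorisation, 1 - α = 2(1 - iw)/den collapses to 2/u = 1 - z₁.
  have hden : den t q = (1 - Complex.I * w) * u := by
    rw [den_eq, hz, hxy2, huw]
    push_cast
    ring
  have hu1 : u * (1 - p.1) = 2 := by rw [hu, div_mul_cancel₀ _ h1]
  have hu0 : u ≠ 0 := fun h0 => by simp [h0] at hu1
  have ha : 1 - alpha t q = 1 - p.1 := by
    rw [one_sub_alpha, hz, hden]
    field_simp
    linear_combination -hu1
  refine Prod.ext (sub_right_injective ha) ?_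
  change beta t q = p.2
  rw [beta, hxy, hden, hb]
  field_simp
  linear_combination -p.2 * hu1

theorem contDiff_hopf : ContDiff ℝ ∞ (fun p : ℝ × R3 => hopf p.1 p.2) := by
  have h2 : ∀ j, ContDiff ℝ ∞ (fun p : ℝ × R3 => ((p.2 j : ℝ) : ℂ)) := fun j =>
    Complex.ofRealCLM.contDiff.comp ((contDiff_apply ℝ ℝ j).comp contDiff_snd)
  have h1 : ContDiff ℝ ∞ (fun p : ℝ × R3 => ((p.1 : ℝ) : ℂ)) :=
    Complex.ofRealCLM.contDiff.comp contDiff_fst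
  have hs : ContDiff ℝ ∞ (fun p : ℝ × R3 => ((sqLen p.2 : ℝ) : ℂ)) := by
    simp only [sqLen]; push_cast
    exact (((h2 0).pow 2).add ((h2 1).pow 2)).add ((h2 2).pow 2)
  have hd : ContDiff ℝ ∞ (fun p : ℝ × R3 => (den p.1 p.2)⁻¹) :=
    (hs.sub ((h1.sub contDiff_const).pow 2)).inv fun p => den_ne_zero p.1 p.2
  simp only [hopf, alpha, beta, div_eq_mul_inv]
  exact ((((hs.sub (h1.pow 2)).sub contDiff_const).add (contDiff_const.mul (h2 2))).mul hd).prodMk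
    ((contDiff_const.mul ((h2 0).sub (contDiff_const.mul (h2 1)))).mul hd)

theorem contDiff_hopf_right (t : ℝ) : ContDiff ℝ ∞ (hopf t) :=
  contDiff_hopf.comp (f := fun q : R3 => (t, q)) (contDiff_const.prodMk contDiff_id)

/-- The formula is smooth wherever 1 - z₁ and Re(2/(1 - z₁)) are nonzero. Smoothness holds on a
neighbourhood in ℂ², so the chain rule applies without manifold structure on S³. -/
theorem contDiffAt_hopfInv (t : ℝ) {p : C2} (hp : p ∈ S3) (hp1 : 1 - p.1 ≠ 0) :
    ContDiffAt ℝ ∞ (fun x : ℝ × C2 => hopfInv x.1 x.2) (t, p) := by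
  have h1 : ContDiffAt ℝ ∞ (fun x : ℝ × C2 => (1 - x.2.1)⁻¹) (t, p) :=
    ContDiffAt.inv (contDiffAt_const.sub contDiffAt_snd.fst) hp1
  have hu : ContDiffAt ℝ ∞ (fun x : ℝ × C2 => 2 * (1 - x.2.1)⁻¹) (t, p) :=
    contDiffAt_const.mul h1
  have hw : ContDiffAt ℝ ∞ (fun x : ℝ × C2 => ((2 * (1 - x.2.1)⁻¹).im - 2 * x.1) *
      ((2 * (1 - x.2.1)⁻¹).re)⁻¹) (t, p) :=
    ((Complex.imCLM.contDiff.contDiffAt.comp _ hu).sub (contDiffAt_const.mul contDiffAt_fst)).mul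
      (ContDiffAt.inv (Complex.reCLM.contDiff.contDiffAt.comp _ hu)
        (two_div_one_sub_re_pos hp hp1).ne')
  have hv := (contDiffAt_snd.snd.mul h1).mul ((contDiffAt_const (c := (1 : ℂ))).sub
    ((contDiffAt_const (c := Complex.I)).mul (Complex.ofRealCLM.contDiff.contDiffAt.comp _ hw)))
  simp only [hopfInv, div_eq_mul_inv]
  rw [contDiffAt_pi]
  intro j
  fin_cases j
  · exact Complex.reCLM.contDiff.contDiffAt.comp _ hv
  · exact (Complex.imCLM.contDiff.contDiffAt.comp _ hv).neg
  · exact hw.add contDiffAt_fst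

theorem contDiffAt_hopfInv_right (t : ℝ) {p : C2} (hp : p ∈ S3) (hp1 : 1 - p.1 ≠ 0) :
    ContDiffAt ℝ ∞ (hopfInv t) p :=
  (contDiffAt_hopfInv t hp hp1).comp p (f := fun p : C2 => (t, p)) (contDiffAt_const.prodMk contDiffAt_id)

theorem hopf_ne (t : ℝ) (q : R3) : hopf t q ≠ (1, 0) := fun hq =>
  one_sub_alpha_ne_zero t q (by rw [show alpha t q = 1 from congrArg Prod.fst hq, sub_self])

/-! ### The isotopy -/

theorem contDiff_hopfInv_comp_hopf {σ τ : ℝ → ℝ} (hσ : ContDiff ℝ ∞ σ) (hτ : ContDiff ℝ ∞ τ) :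
    ContDiff ℝ ∞ (fun p : ℝ × R3 => hopfInv (σ p.1) (hopf (τ p.1) p.2)) :=
  contDiff_iff_contDiffAt.2 fun p =>
    (contDiffAt_hopfInv (σ p.1) (hopf_mem_S3 (τ p.1) p.2) (one_sub_alpha_ne_zero _ _)).comp p
      (f := fun p : ℝ × R3 => (σ p.1, hopf (τ p.1) p.2))
      ((hσ.comp contDiff_fst).prodMk
        (contDiff_hopf.comp ((hτ.comp contDiff_fst).prodMk contDiff_snd))).contDiffAt

theorem isAmbientIsotopy_hopf (t : ℝ) :
    IsAmbientIsotopy (fun s q => hopfInv (s * t) (hopf 0 q)) := by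
  have hst : ContDiff ℝ ∞ (fun s : ℝ => s * t) := contDiff_id.mul contDiff_const
  have h0 : ContDiff ℝ ∞ (fun _ : ℝ => (0 : ℝ)) := contDiff_const
  have hl : ∀ (σ τ : ℝ) (q : R3), hopfInv σ (hopf τ (hopfInv τ (hopf σ q))) = q := fun σ τ q => by
    rw [hopf_hopfInv _ (hopf_mem_S3 _ _) (hopf_ne _ _), hopfInv_hopf]
  have hl' : ∀ s : ℝ, Function.LeftInverse (fun q => hopfInv 0 (hopf (s * t) q))
      (fun q => hopfInv (s * t) (hopf 0 q)) := fun s q => hl 0 (s * t) q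
  have hr' : ∀ s : ℝ, Function.RightInverse (fun q => hopfInv 0 (hopf (s * t) q))
      (fun q => hopfInv (s * t) (hopf 0 q)) := fun s q => hl (s * t) 0 q
  have h1 : (fun q => hopfInv (0 * t) (hopf 0 q)) = id := funext fun q => by
    rw [zero_mul, hopfInv_hopf, id]
  have h2 := contDiff_hopfInv_comp_hopf hst h0
  have h3 := contDiff_hopfInv_comp_hopf h0 hst
  exact ⟨h1, h2, fun s q => hopfInv 0 (hopf (s * t) q), h3, fun s => ⟨hl' s, hr' s⟩⟩

theorem stereoInv_eq (q : R3) : stereoInv q = reflection (hopf 0 q) := by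
  have hd : den 0 q = (sqLen q : ℂ) + 1 := by simp [den]
  simp only [stereoInv, reflection, hopf, alpha, beta, hd]
  refine Prod.ext ?_ ?_ <;> simp [Complex.conj_ofNat]

/-- At t = 0, β has numerator 2(x - iy) where stereographic projection has 2(x + iy); this
conjugation is the mirror reflection. -/
theorem mirrorImage_eq (A : Set C2) : mirrorImage A = hopf 0 ⁻¹' A := by
  have hr : Function.Injective reflection := fun p p' hpp => by
    simp only [reflection, Prod.mk.injEq] at hpp
    exact Prod.ext hpp.1 (star_injective hpp.2)
  ext q
  simp only [mirrorImage, Set.mem_ofPred_eq, stereoInv_eq, hr.mem_set_image, Set.mem_preimage]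

/-! ### The gradients of the Hopfion variables -/

theorem hasFDerivAt_ofReal_apply (q : R3) (j : Fin 3) :
    HasFDerivAt (fun q : R3 => ((q j : ℝ) : ℂ))
      (Complex.ofRealCLM.comp (ContinuousLinearMap.proj (R := ℝ) (φ := fun _ : Fin 3 => ℝ) j)) q :=
  (Complex.ofRealCLM.comp
    (ContinuousLinearMap.proj (R := ℝ) (φ := fun _ : Fin 3 => ℝ) j)).hasFDerivAt (x := q)

theorem hasFDerivAt_sqLen (q : R3) :
    HasFDerivAt (fun q : R3 => ((sqLen q : ℝ) : ℂ))
      (∑ j : Fin 3, (2 * (q j : ℂ)) • Complex.ofRealCLM.comp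
        (ContinuousLinearMap.proj (R := ℝ) (φ := fun _ : Fin 3 => ℝ) j)) q := by
  have h := fun j => (hasFDerivAt_ofReal_apply q j).pow 2
  have := ((h 0).add (h 1)).add (h 2)
  simp only [sqLen]
  push_cast
  refine this.congr_fderiv ?_
  rw [Fin.sum_univ_three]
  simp

/-- The product rule for f · den, with ∂_j den = 2q_j, solved for ∂_j f; it keeps a single power of
the denominator. -/
theorem gradient_eq_of_mul_den {f : R3 → ℂ} {t : ℝ} {q : R3} (hf : DifferentiableAt ℝ f q)
    {A : R3 →L[ℝ] ℂ} (hA : HasFDerivAt (fun q => f q * den t q) A q) (j : Fin 3) :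
    gradient f q j = (A (Pi.single j 1) - f q * (2 * (q j : ℂ))) / den t q := by
  have hD : HasFDerivAt (den t) _ q := (hasFDerivAt_sqLen q).sub_const (((t : ℂ) - Complex.I) ^ 2)
  have := DFunLike.congr_fun (hA.unique (hf.hasFDerivAt.mul hD)) (Pi.single j 1)
  rw [eq_div_iff (den_ne_zero t q), gradient, this]
  fin_cases j <;> simp [Fin.sum_univ_three] <;> ring

theorem differentiable_alpha (t : ℝ) : Differentiable ℝ (alpha t) :=
  (contDiff_hopf_right t).fst.differentiable (by simp)

theorem differentiable_beta (t : ℝ) : Differentiable ℝ (beta t) :=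
  (contDiff_hopf_right t).snd.differentiable (by simp)

theorem gradient_alpha (t : ℝ) (q : R3) (j : Fin 3) : gradient (alpha t) q j =
    (![2 * (q 0 : ℂ), 2 * (q 1 : ℂ), 2 * (q 2 : ℂ) + 2 * Complex.I] j
      - alpha t q * (2 * (q j : ℂ))) / den t q := by
  have hA := (((hasFDerivAt_sqLen q).sub_const ((t : ℂ) ^ 2)).sub_const 1).fun_add
    ((hasFDerivAt_ofReal_apply q 2).const_mul (2 * Complex.I))
  have e : (fun q => alpha t q * den t q) = _ := funext fun q => by
    rw [alpha, div_mul_cancel₀ _ (den_ne_zero t q)]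
  rw [gradient_eq_of_mul_den (differentiable_alpha t q) (e ▸ hA)]
  fin_cases j <;> simp [Fin.sum_univ_three]

theorem gradient_beta (t : ℝ) (q : R3) (j : Fin 3) : gradient (beta t) q j =
    (![2, -(2 * Complex.I), 0] j - beta t q * (2 * (q j : ℂ))) / den t q := by
  have hB := ((hasFDerivAt_ofReal_apply q 0).fun_sub
    ((hasFDerivAt_ofReal_apply q 1).const_mul Complex.I)).const_mul 2
  have e : (fun q => beta t q * den t q) = _ := funext fun q => by
    rw [beta, div_mul_cancel₀ _ (den_ne_zero t q)]
  rw [gradient_eq_of_mul_den (differentiable_beta t q) (e ▸ hB)]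
  fin_cases j <;> simp

/-- The Jacobian factor of `hopf t`. -/
def jacobian (t : ℝ) (q : R3) : ℝ :=
  16 * (1 + q 0 ^ 2 + q 1 ^ 2 + (q 2 - t) ^ 2) / Complex.normSq (den t q) ^ 2

theorem jacobian_pos (t : ℝ) (q : R3) : 0 < jacobian t q :=
  div_pos (by positivity) (pow_pos (Complex.normSq_pos.2 (den_ne_zero t q)) 2)

theorem conj_den (t : ℝ) (q : R3) :
    conj (den t q) = (sqLen q : ℂ) - ((t : ℂ) + Complex.I) ^ 2 := by
  simp [den]

/-- `∇α × ∇β` in closed form. -/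
theorem gradient_cross (t : ℝ) (q : R3) (m p : ℂ) (hm : m = (q 0 : ℂ) - Complex.I * (q 1 : ℂ))
    (hp : p = 1 - Complex.I * ((q 2 : ℂ) - t)) :
    gradient (alpha t) q ⨯₃ gradient (beta t) q = fun j => -4 / den t q ^ 3 *
      ![m ^ 2 + p ^ 2, Complex.I * (m ^ 2 - p ^ 2), 2 * Complex.I * (p * m)] j := by
  have hd := den_ne_zero t q
  have hI := Complex.I_sq
  have hD : den t q = (q 0 : ℂ) ^ 2 + (q 1 : ℂ) ^ 2 + (q 2 : ℂ) ^ 2 - ((t : ℂ) - Complex.I) ^ 2 := by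
    simp only [den, sqLen]; push_cast; rfl
  have hs : (sqLen q : ℂ) = den t q + ((t : ℂ) - Complex.I) ^ 2 := by simp only [den]; ring
  subst hm hp
  funext j
  simp only [cross_apply, gradient_alpha, gradient_beta, alpha, beta, hs]
  generalize den t q = D at *
  fin_cases j <;> simp <;> field_simp <;> grind

/-- Together with its analogue for β, this gives the image under d(α, β) of the conjugate of ∇α ×
∇β, the only half of a real part that is not annihilated. -/
theorem gradient_alpha_dot_conj_cross (t : ℝ) (q : R3) :
    (fun j => conj (gradient (alpha t) q j)) ⬝ᵥ (gradient (alpha t) q ⨯₃ gradient (beta t) q) =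
      -(jacobian t q : ℂ) * beta t q := by
  have hd := den_ne_zero t q
  have hd' : conj (den t q) ≠ 0 := by simpa using hd
  have hI := Complex.I_sq
  have hD : den t q = (q 0 : ℂ) ^ 2 + (q 1 : ℂ) ^ 2 + (q 2 : ℂ) ^ 2 - ((t : ℂ) - Complex.I) ^ 2 := by
    simp only [den, sqLen]; push_cast; rfl
  have hD' : conj (den t q) =
      (q 0 : ℂ) ^ 2 + (q 1 : ℂ) ^ 2 + (q 2 : ℂ) ^ 2 - ((t : ℂ) + Complex.I) ^ 2 := by
    rw [conj_den]; simp only [sqLen]; push_cast; rfl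
  have hs : (sqLen q : ℂ) = conj (den t q) + ((t : ℂ) + Complex.I) ^ 2 := by rw [conj_den]; ring
  rw [gradient_cross t q _ _ rfl rfl]
  simp only [dotProduct, Fin.sum_univ_three, gradient_alpha, jacobian]
  push_cast
  rw [← Complex.mul_conj]
  simp [alpha, beta, Complex.conj_ofNat]
  rw [hs]
  -- The denominator and its conjugate become independent variables tied to q and t by `hD` and
  -- `hD'`; a polynomial identity modulo i² = -1 remains.
  generalize conj (den t q) = D' at *
  generalize den t q = D at *
  field_simp
  grind

theorem gradient_beta_dot_conj_cross (t : ℝ) (q : R3) :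
    (fun j => conj (gradient (beta t) q j)) ⬝ᵥ (gradient (alpha t) q ⨯₃ gradient (beta t) q) =
      (jacobian t q : ℂ) * alpha t q := by
  have hd := den_ne_zero t q
  have hd' : conj (den t q) ≠ 0 := by simpa using hd
  have hI := Complex.I_sq
  have hD : den t q = (q 0 : ℂ) ^ 2 + (q 1 : ℂ) ^ 2 + (q 2 : ℂ) ^ 2 - ((t : ℂ) - Complex.I) ^ 2 := by
    simp only [den, sqLen]; push_cast; rfl
  have hD' : conj (den t q) =
      (q 0 : ℂ) ^ 2 + (q 1 : ℂ) ^ 2 + (q 2 : ℂ) ^ 2 - ((t : ℂ) + Complex.I) ^ 2 := by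
    rw [conj_den]; simp only [sqLen]; push_cast; rfl
  have hs : (sqLen q : ℂ) = conj (den t q) + ((t : ℂ) + Complex.I) ^ 2 := by rw [conj_den]; ring
  rw [gradient_cross t q _ _ rfl rfl]
  simp only [dotProduct, Fin.sum_univ_three, gradient_beta, jacobian]
  push_cast
  rw [← Complex.mul_conj]
  simp [alpha, beta, Complex.conj_ofNat]
  rw [hs]
  generalize conj (den t q) = D' at *
  generalize den t q = D at *
  field_simp
  grind

/-! ### The push-forward of the field to the sphere -/

theorem fderiv_apply_eq_dotProduct_gradient (f : R3 → ℂ) (q V : R3) :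
    fderiv ℝ f q V = gradient f q ⬝ᵥ fun j => (V j : ℂ) := by
  have hV : V = ∑ j, V j • (Pi.single j 1 : R3) := by
    funext k
    simp [Finset.sum_apply, Pi.single_apply]
  conv_lhs => rw [hV]
  simp only [map_sum, map_smul, dotProduct, gradient]
  exact Finset.sum_congr rfl fun j _ => by rw [Complex.real_smul, mul_comm]

theorem dotProduct_conj (a b : Fin 3 → ℂ) :
    (a ⬝ᵥ fun j => conj (b j)) = conj ((fun j => conj (a j)) ⬝ᵥ b) := by
  simp [dotProduct]

/-- The real part of a complex multiple of `∇α × ∇β` is mapped by the differential of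
`(α, β)` to a complex multiple of `(-conj β, conj α)`. -/
theorem fderiv_hopf_re (t : ℝ) (q : R3) (η : ℂ) :
    fderiv ℝ (hopf t) q
      (fun j => ((η • (gradient (alpha t) q ⨯₃ gradient (beta t) q)) j).re) =
      ((jacobian t q / 2 * conj η) * -conj (beta t q),
        (jacobian t q / 2 * conj η) * conj (alpha t q)) := by
  set Gc := gradient (alpha t) q ⨯₃ gradient (beta t) q
  -- Half the sum with the conjugate: the first summand is killed by ∇α and ∇β as a triple product.
  have hre : (fun j => ((((η • Gc) j).re : ℝ) : ℂ)) =
      (η / 2) • Gc + (conj η / 2) • fun j => conj (Gc j) := funext fun j => by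
    simp only [Pi.add_apply, Pi.smul_apply, smul_eq_mul, Complex.re_eq_add_conj, map_mul]
    ring
  have hd : fderiv ℝ (hopf t) q = (fderiv ℝ (alpha t) q).prod (fderiv ℝ (beta t) q) :=
    ((differentiable_alpha t q).hasFDerivAt.prodMk (differentiable_beta t q).hasFDerivAt).fderiv
  rw [hd, ContinuousLinearMap.prod_apply]
  simp only [fderiv_apply_eq_dotProduct_gradient, hre, dotProduct_add, dotProduct_smul,
    dotProduct_conj]
  rw [gradient_alpha_dot_conj_cross, gradient_beta_dot_conj_cross, dot_self_cross,
    dot_cross_self]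
  simp only [map_mul, map_neg, Complex.conj_ofReal, smul_eq_mul, mul_zero, zero_add]
  refine Prod.ext ?_ ?_ <;> simp only <;> ring

theorem fderiv_hopf_electricField (h : C2 → ℂ) (t : ℝ) (q : R3) :
    fderiv ℝ (hopf t) q (electricField h t q) =
      ((jacobian t q / 2 * conj (h (hopf t q))) * -conj (beta t q),
        (jacobian t q / 2 * conj (h (hopf t q))) * conj (alpha t q)) :=
  fderiv_hopf_re t q (h (hopf t q))

/-- Since Im F = Re(-iF), this is the electric case for -ih, whose conjugate is i conj h. -/
theorem fderiv_hopf_magneticField (h : C2 → ℂ) (t : ℝ) (q : R3) :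
    fderiv ℝ (hopf t) q (magneticField h t q) =
      ((jacobian t q / 2 * (Complex.I * conj (h (hopf t q)))) * -conj (beta t q),
        (jacobian t q / 2 * (Complex.I * conj (h (hopf t q)))) * conj (alpha t q)) := by
  have := fderiv_hopf_re t q (-Complex.I * h (hopf t q))
  rw [map_mul, map_neg, Complex.conj_I, neg_neg] at this
  rw [← this]
  congr 1
  funext j
  simp only [magneticField, batemanField, Pi.smul_apply, smul_eq_mul, mul_assoc, hopf]
  simp only [neg_mul, Complex.neg_re, Complex.I_mul_re, neg_neg]

theorem continuous_gradient {f : R3 → ℂ} (hf : ContDiff ℝ ∞ f) : Continuous (gradient f) :=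
  continuous_pi fun _ => (hf.continuous_fderiv (by simp)).clm_apply continuous_const

theorem continuous_batemanField {U : Set C2} (hSU : S3 ⊆ U) {h : C2 → ℂ} (hh : ContinuousOn h U)
    (t : ℝ) : Continuous (batemanField h t) := by
  have h1 : Continuous fun q => h (hopf t q) :=
    hh.comp_continuous (contDiff_hopf_right t).continuous fun q => hSU (hopf_mem_S3 t q)
  have h2 := continuous_gradient (contDiff_hopf_right t).fst
  have h3 := continuous_gradient (contDiff_hopf_right t).snd
  have h2' : ∀ j, Continuous fun q => gradient (alpha t) q j := fun j =>
    (continuous_apply j).comp h2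
  have h3' : ∀ j, Continuous fun q => gradient (beta t) q j := fun j =>
    (continuous_apply j).comp h3
  refine h1.smul ?_
  simp only [cross_apply]
  refine continuous_pi fun j => ?_
  fin_cases j
  · exact ((h2' 1).mul (h3' 2)).sub ((h2' 2).mul (h3' 1))
  · exact ((h2' 2).mul (h3' 0)).sub ((h2' 0).mul (h3' 2))
  · exact ((h2' 0).mul (h3' 1)).sub ((h2' 1).mul (h3' 0))

/-! ### Legendrian curves -/

/-- A Legendrian tangent vector `w` at the point `p` of the sphere is the complex multiple of
`v1 p` with factor `w · v1 + i w · v2`. -/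
theorem eq_mul_v1_of_legendrian {p w : C2} (hp : p ∈ S3) (hw : dot4 p w = 0)
    (hc : contactForm p w = 0) :
    w = ((⟨dot4 w (v1 p), dot4 w (v2 p)⟩ : ℂ) * -conj p.2,
      (⟨dot4 w (v1 p), dot4 w (v2 p)⟩ : ℂ) * conj p.1) := by
  obtain ⟨⟨x1, y1⟩, ⟨x2, y2⟩⟩ := p
  obtain ⟨⟨a1, b1⟩, ⟨a2, b2⟩⟩ := w
  simp only [S3, Set.mem_ofPred_eq, Complex.normSq_apply, dot4, contactForm, v1, v2] at *
  -- Expansion of w in the orthonormal basis p, ip, v₁, v₂ = i v₁; its components along p and ip are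
  -- `dot4 p w` and `contactForm p w`, both zero.
  refine Prod.ext (Complex.ext ?_ ?_) (Complex.ext ?_ ?_) <;>
    simp only [Complex.mul_re, Complex.mul_im, Complex.neg_re, Complex.neg_im, Complex.conj_re,
      Complex.conj_im]
  · linear_combination -a1 * hp + x1 * hw - y1 * hc
  · linear_combination -b1 * hp + y1 * hw + x1 * hc
  · linear_combination -a2 * hp + x2 * hw - y2 * hc
  · linear_combination -b2 * hp + y2 * hw + x2 * hc

theorem dot4_deriv_eq_zero {c : ℝ → C2} {s : ℝ} (hc : DifferentiableAt ℝ c s)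
    (hS : ∀ s, c s ∈ S3) : dot4 (c s) (deriv c s) = 0 := by
  have h := hc.hasDerivAt
  have h1 := h.fst
  have h2 := h.snd
  have hr : ∀ {f : ℝ → ℂ} {f' : ℂ}, HasDerivAt f f' s → HasDerivAt (fun s => (f s).re) f'.re s :=
    fun hf => Complex.reCLM.hasFDerivAt.comp_hasDerivAt s hf
  have hi : ∀ {f : ℝ → ℂ} {f' : ℂ}, HasDerivAt f f' s → HasDerivAt (fun s => (f s).im) f'.im s :=
    fun hf => Complex.imCLM.hasFDerivAt.comp_hasDerivAt s hf
  have hsum := ((((hr h1).pow 2).fun_add ((hi h1).pow 2)).fun_add ((hr h2).pow 2)).fun_add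
    ((hi h2).pow 2)
  have hone : (fun s => (c s).1.re ^ 2 + (c s).1.im ^ 2 + (c s).2.re ^ 2 + (c s).2.im ^ 2)
      = fun _ => 1 := funext fun s => by
    have := hS s
    simp only [S3, Set.mem_ofPred_eq, Complex.normSq_apply] at this
    linear_combination this
  have := hsum.unique (hone ▸ hasDerivAt_const s (1 : ℝ))
  simp at this
  simp only [dot4]
  linarith

theorem dot4_smul (k : ℝ) (w v : C2) : dot4 (k • w) v = k * dot4 w v := by
  simp [dot4]; ring

/-- The preimage under `hopf t` of a closed Legendrian curve is a closed field line of every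
continuous vector field whose push-forward along the curve is tangent to it. -/
theorem isClosedFieldLine_hopfInv {c : ℝ → C2} (hc : ContDiff ℝ ∞ c)
    (hper : Function.Periodic c (2 * Real.pi)) (himm : ∀ s, deriv c s ≠ 0)
    (hS : ∀ s, c s ∈ S3) (hpole : ∀ s, c s ≠ (1, 0))
    (hleg : ∀ s, contactForm (c s) (deriv c s) = 0) {t : ℝ} {G : R3 → R3} (hG : Continuous G)
    {η : C2 → ℂ} (hη : ∀ s, ∃ k : ℝ, k ≠ 0 ∧
      η (c s) = k * ⟨dot4 (deriv c s) (v1 (c s)), dot4 (deriv c s) (v2 (c s))⟩)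
    (hGη : ∀ q, fderiv ℝ (hopf t) q (G q) = ((jacobian t q / 2 * η (hopf t q)) * -conj (beta t q),
        (jacobian t q / 2 * η (hopf t q)) * conj (alpha t q))) :
    IsClosedFieldLine G (Set.range fun s => hopfInv t (c s)) := by
  have hinv : ∀ s, hopf t (hopfInv t (c s)) = c s := fun s => hopf_hopfInv t (hS s) (hpole s)
  have hsm : ∀ s, ContDiffAt ℝ ∞ (hopfInv t) (c s) := fun s =>
    contDiffAt_hopfInv_right t (hS s) (one_sub_fst_ne_zero (hS s) (hpole s))
  have hcd : ContDiff ℝ ∞ (fun s => hopfInv t (c s)) :=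
    contDiff_iff_contDiffAt.2 fun s => (hsm s).comp s hc.contDiffAt
  have hd : ∀ s, deriv (fun s => hopfInv t (c s)) s = fderiv ℝ (hopfInv t) (c s) (deriv c s) :=
    fun s => (((hsm s).differentiableAt (by simp)).hasFDerivAt.comp_hasDerivAt s
      (hc.differentiable (by simp) s).hasDerivAt).deriv
  -- The differential of `hopf t` has a left inverse, so an identity between push-forwards on the
  -- sphere can be pulled back to ℝ³.
  have hleft : ∀ s V, fderiv ℝ (hopfInv t) (c s) (fderiv ℝ (hopf t) (hopfInv t (c s)) V) = V := by
    intro s V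
    have h1 := (hinv s).symm ▸ ((hsm s).differentiableAt (by simp)).hasFDerivAt
    have h2 := ((contDiff_hopf_right t).differentiable (by simp) (hopfInv t (c s))).hasFDerivAt
    have h3 := h1.comp _ h2
    rw [hinv] at h3
    have h4 : hopfInv t ∘ hopf t = id := funext (hopfInv_hopf t)
    rw [h4] at h3
    exact DFunLike.congr_fun (h3.unique (hasFDerivAt_id _)) V
  refine isClosedFieldLine_of_tangent hG (hcd.of_le (by simp)) Real.two_pi_pos
    (fun s => by simp only [hper s]) (fun s hs => himm s ?_) fun s => ?_
  · have h1 := (hcd.differentiable (by simp) s).hasDerivAt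
    have h2 := ((contDiff_hopf_right t).differentiable (by simp)
      (hopfInv t (c s))).hasFDerivAt.comp_hasDerivAt s h1
    have h3 : hopf t ∘ (fun s => hopfInv t (c s)) = c := funext hinv
    rw [h3, hs, map_zero] at h2
    exact h2.deriv
  · obtain ⟨k, hk, hks⟩ := hη s
    have hw := eq_mul_v1_of_legendrian (hS s)
      (dot4_deriv_eq_zero (hc.differentiable (by simp) s) hS) (hleg s)
    set J := jacobian t (hopfInv t (c s)) with hJ
    have hJ0 : 0 < J := jacobian_pos _ _
    refine ⟨J / 2 * k, mul_ne_zero (by positivity) hk, ?_⟩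
    have hab : (alpha t (hopfInv t (c s)), beta t (hopfInv t (c s))) = c s := hinv s
    have ha : alpha t (hopfInv t (c s)) = (c s).1 := congrArg Prod.fst hab
    have hb : beta t (hopfInv t (c s)) = (c s).2 := congrArg Prod.snd hab
    have key : fderiv ℝ (hopf t) (hopfInv t (c s)) (G (hopfInv t (c s)))
        = (J / 2 * k) • deriv c s := by
      rw [hGη, hinv, hks, ha, hb, ← hJ]
      conv_rhs => rw [hw]
      refine Prod.ext ?_ ?_ <;> simp only [Prod.smul_mk, Complex.real_smul] <;> push_cast <;> ring
    rw [hd, ← map_smul, ← key, hleft]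

end

end BatemanLinks

theorem mainTheorem4 {n : ℕ} (γ : Fin n → ℝ → BatemanLinks.C2)
    (hlink : BatemanLinks.IsLinkParam γ)
    (hleg : BatemanLinks.IsLegendrian γ)
    (hpole : ∀ i s, γ i s ≠ (1, 0))
    (I : Finset (Fin n))
    (X : BatemanLinks.C2 → BatemanLinks.C2)
    (hX : BatemanLinks.IsNonvanishingTangentSection γ X)
    (U : Set BatemanLinks.C2) (hU : IsOpen U) (hSU : BatemanLinks.S3 ⊆ U)
    (h : BatemanLinks.C2 → ℂ) (hhol : DifferentiableOn ℂ h U)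
    (hH : ∀ i s, h (γ i s) = BatemanLinks.coeffH I X i (γ i s)) :
    ∀ t : ℝ, ∃ K : Fin n → Set BatemanLinks.R3,
      (∀ i ∈ I, BatemanLinks.IsClosedFieldLine (BatemanLinks.electricField h t) (K i)) ∧
      (∀ i ∉ I, BatemanLinks.IsClosedFieldLine (BatemanLinks.magneticField h t) (K i)) ∧
      BatemanLinks.AmbientIsotopic
        (fun i => BatemanLinks.mirrorImage (Set.range (γ i))) K := by
  open BatemanLinks in
  intro t
  have hF : ∀ j, Continuous fun q => batemanField h t q j := fun j =>
    (continuous_apply j).comp (continuous_batemanField hSU hhol.continuousOn t)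
  refine ⟨fun i => Set.range fun s => hopfInv t (γ i s), fun i hi => ?_, fun i hi => ?_,
    _, isAmbientIsotopy_hopf t, fun i => ?_⟩
  · refine isClosedFieldLine_hopfInv (η := fun p => conj (h p)) (hlink.smooth i)
      (hlink.periodic i) (hlink.immersed i) (hlink.mem_sphere i) (hpole i) (hleg i)
      (continuous_pi fun j => Complex.continuous_re.comp (hF j)) (fun s => ?_)
      (fderiv_hopf_electricField h t)
    obtain ⟨k, hk, hks⟩ := hX i s
    refine ⟨k, hk, ?_⟩
    -- Here h = X·v₁ - i X·v₂, so conj h is the factor of X = k γ' relative to v₁.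
    rw [hH, coeffH, if_pos hi, hks, dot4_smul, dot4_smul]
    apply Complex.ext <;> simp
  · refine isClosedFieldLine_hopfInv (η := fun p => Complex.I * conj (h p)) (hlink.smooth i)
      (hlink.periodic i) (hlink.immersed i) (hlink.mem_sphere i) (hpole i) (hleg i)
      (continuous_pi fun j => Complex.continuous_im.comp (hF j)) (fun s => ?_)
      (fderiv_hopf_magneticField h t)
    obtain ⟨k, hk, hks⟩ := hX i s
    refine ⟨k, hk, ?_⟩
    -- Here h = X·v₂ + i X·v₁, and i conj h is again X·v₁ + i X·v₂.
    rw [hH, coeffH, if_neg hi, hks, dot4_smul, dot4_smul]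
    apply Complex.ext <;> simp
  · beta_reduce
    rw [mirrorImage_eq]
    ext q
    simp only [Set.mem_image, Set.mem_preimage, Set.mem_range, one_mul]
    constructor
    · rintro ⟨q', ⟨s, hs⟩, rfl⟩
      exact ⟨s, by rw [hs]⟩
    · rintro ⟨s, rfl⟩
      have hs := hopf_hopfInv 0 (hlink.mem_sphere i s) (hpole i s)
      exact ⟨hopfInv 0 (γ i s), ⟨s, hs.symm⟩, by rw [hs]⟩
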